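/- For complex $a,q$ with $|q|<1$ write $(a;q)_n=\prod_{k=0}^{n-1}(1-aq^k)$ for $n\ge 0$, $(a;q)_\infty=\prod_{k=0}^{\infty}(1-aq^k)$, and $(a_1,a_2,a_3;q)_\infty=(a_1;q)_\infty(a_2;q)_\infty(a_3;q)_\infty$. Let $q\in\mathbb{C}$ with $|q|<1$. Then all denominators below are nonzero, the series on the left converges absolutely, and $$\sum_{n=0}^{\infty}\frac{(q;q^2)_{2n}\,q^{2n^2+4n}(-1)^n}{(q^8;q^8)_n\,(-q^2;q^4)_{n+1}}=(-q^9,-q^7,q^8;q^8)_\infty\,\frac{(q^2;q^4)_\infty}{(q^4;q^4)_\infty}.$$ -/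

import Mathlib

/-- The finite `q`-shifted factorial `(a; q)_n = (1 - a) (1 - a q) ⋯ (1 - a q ^ (n - 1))`. -/
noncomputable def qPoch (a q : ℂ) (n : ℕ) : ℂ :=
  ∏ k ∈ Finset.range n, (1 - a * q ^ k)

/-- The infinite `q`-shifted factorial `(a; q)_∞ = ∏_{k ≥ 0} (1 - a q ^ k)`, for `‖q‖ < 1`. -/
noncomputable def qPochInf (a q : ℂ) : ℂ :=
  ∏' k : ℕ, (1 - a * q ^ k)

/-- The product defining `(a; q)_∞` converges, so that `qPochInf` is its genuine value. -/
theorem multipliable_qPochInf (a : ℂ) {q : ℂ} (hq : ‖q‖ < 1) :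
    Multipliable fun k : ℕ => 1 - a * q ^ k := by
  have h : Summable fun k : ℕ => ‖-(a * q ^ k)‖ := by
    simpa [norm_mul, norm_pow] using
      (summable_geometric_of_lt_one (norm_nonneg q) hq).mul_left ‖a‖
  simpa [sub_eq_add_neg] using multipliable_one_add_of_summable h

/-!
The identity is an instance of the `q`-analogue of Bailey's summation theorem. With `p = q ^ 4`,
`a = q`, `c = q ^ 3`, so that `a * c = p`, and `b = -q ^ 6`, the series on the left is, up to the
factor `(-q ^ 2; q ^ 4)_∞`, the value at `b` of
`F b = ∑ (a; p)_n (c; p)_n p ^ (n choose 2) b ^ n (b p ^ n; p)_∞ / (p ^ 2; p ^ 2)_n`.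

The function `F` satisfies `F b = (1 - a b) (1 - c b) F (b p ^ 2)`, because the difference of the
two sides telescopes term by term (`baileyTerm_sub`). Iterating and using `F b → 1` as `b → 0`,
which is dominated convergence, gives `F b = (a b; p ^ 2)_∞ (c b; p ^ 2)_∞`
(`hasSum_baileyTerm`). The remaining infinite products are matched by
`(x; q)_∞ (-x; q)_∞ = (x ^ 2; q ^ 2)_∞` and by splitting a product into its even and odd factors.
-/

open Filter Topology

/-! ### The `q`-shifted factorials -/

theorem norm_sq_lt_one {p : ℂ} (hp : ‖p‖ < 1) : ‖p ^ 2‖ < 1 := by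
  rw [norm_pow]
  exact pow_lt_one₀ (norm_nonneg p) hp two_ne_zero

theorem qPoch_zero (a q : ℂ) : qPoch a q 0 = 1 := by simp [qPoch]

theorem qPoch_succ (a q : ℂ) (n : ℕ) : qPoch a q (n + 1) = qPoch a q n * (1 - a * q ^ n) := by
  simp [qPoch, Finset.prod_range_succ]

theorem one_sub_mul_pow_ne_zero {a q : ℂ} (ha : ‖a‖ < 1) (hq : ‖q‖ < 1) (n : ℕ) :
    1 - a * q ^ n ≠ 0 := by
  intro h
  have h1 : ‖a * q ^ n‖ = 1 := by rw [← sub_eq_zero.mp h, norm_one]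
  have h2 : ‖a * q ^ n‖ ≤ ‖a‖ * 1 := by
    rw [norm_mul, norm_pow]
    gcongr
    exact pow_le_one₀ (norm_nonneg q) hq.le
  linarith

theorem qPoch_ne_zero {a q : ℂ} (ha : ‖a‖ < 1) (hq : ‖q‖ < 1) (n : ℕ) : qPoch a q n ≠ 0 :=
  Finset.prod_ne_zero_iff.mpr fun k _ => one_sub_mul_pow_ne_zero ha hq k

theorem qPochInf_ne_zero {a q : ℂ} (ha : ‖a‖ < 1) (hq : ‖q‖ < 1) : qPochInf a q ≠ 0 := by
  have h := tprod_one_add_ne_zero_of_summable (f := fun k : ℕ => -(a * q ^ k))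
    (fun k => by simpa [sub_eq_add_neg] using one_sub_mul_pow_ne_zero ha hq k)
    (by simpa [norm_mul, norm_pow] using
      (summable_geometric_of_lt_one (norm_nonneg q) hq).mul_left ‖a‖)
  simpa [qPochInf, sub_eq_add_neg] using h

theorem tendsto_qPoch (a : ℂ) {q : ℂ} (hq : ‖q‖ < 1) :
    Tendsto (qPoch a q) atTop (𝓝 (qPochInf a q)) :=
  (multipliable_qPochInf a hq).tendsto_prod_tprod_nat

theorem qPochInf_eq_mul (a : ℂ) {q : ℂ} (hq : ‖q‖ < 1) :
    qPochInf a q = (1 - a) * qPochInf (a * q) q := by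
  refine tendsto_nhds_unique ((tendsto_qPoch a hq).comp (tendsto_add_atTop_nat 1)) ?_
  refine ((tendsto_qPoch (a * q) hq).const_mul (1 - a)).congr fun n => ?_
  simp only [qPoch, Function.comp_apply, Finset.prod_range_succ', pow_zero, mul_one, mul_assoc,
    ← pow_succ']
  exact mul_comm _ _

theorem qPoch_mul_qPochInf (a : ℂ) {q : ℂ} (hq : ‖q‖ < 1) (n : ℕ) :
    qPoch a q n * qPochInf (a * q ^ n) q = qPochInf a q := by
  induction n with
  | zero => simp [qPoch_zero]
  | succ n ih =>
    rw [← ih, qPoch_succ, qPochInf_eq_mul (a * q ^ n) hq]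
    ring_nf

theorem norm_qPochInf_sub_one_le (a : ℂ) {q : ℂ} (hq : ‖q‖ < 1) :
    ‖qPochInf a q - 1‖ ≤ Real.exp (‖a‖ * (1 - ‖q‖)⁻¹) - 1 := by
  refine le_of_tendsto ((tendsto_qPoch a hq).sub_const 1).norm (Eventually.of_forall fun n => ?_)
  have h := (Finset.range n).norm_prod_one_add_sub_one_le fun k => -(a * q ^ k)
  simp only [← sub_eq_add_neg] at h
  refine h.trans (sub_le_sub_right (Real.exp_le_exp.mpr ?_) 1)
  simp only [norm_neg, norm_mul, norm_pow, ← Finset.mul_sum]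
  gcongr
  rw [← tsum_geometric_of_lt_one (norm_nonneg q) hq]
  exact (summable_geometric_of_lt_one (norm_nonneg q) hq).sum_le_tsum _ fun _ _ => by positivity

theorem norm_qPochInf_le {a q : ℂ} (ha : ‖a‖ ≤ 1) (hq : ‖q‖ < 1) :
    ‖qPochInf a q‖ ≤ Real.exp (1 - ‖q‖)⁻¹ := by
  have h1 := norm_qPochInf_sub_one_le a hq
  have h2 : ‖qPochInf a q‖ ≤ ‖qPochInf a q - 1‖ + 1 := by
    simpa using norm_add_le (qPochInf a q - 1) 1
  have h3 : Real.exp (‖a‖ * (1 - ‖q‖)⁻¹) ≤ Real.exp (1 - ‖q‖)⁻¹ := by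
    refine Real.exp_le_exp.mpr (mul_le_of_le_one_left ?_ ha)
    exact inv_nonneg.mpr (sub_nonneg.mpr hq.le)
  linarith

/-- Continuity of `a ↦ (a; q)_∞` at `a = 0`. -/
theorem tendsto_qPochInf_one {u : ℕ → ℂ} (hu : Tendsto u atTop (𝓝 0)) {q : ℂ} (hq : ‖q‖ < 1) :
    Tendsto (fun m => qPochInf (u m) q) atTop (𝓝 1) := by
  rw [tendsto_iff_norm_sub_tendsto_zero]
  refine squeeze_zero (fun _ => norm_nonneg _) (fun m => norm_qPochInf_sub_one_le (u m) hq) ?_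
  have h : Tendsto (fun m => ‖u m‖ * (1 - ‖q‖)⁻¹) atTop (𝓝 0) := by
    simpa using hu.norm.mul_const (1 - ‖q‖)⁻¹
  simpa using ((Real.continuous_exp.tendsto 0).comp h).sub_const 1

theorem qPoch_two_mul (a q : ℂ) (n : ℕ) :
    qPoch a q (2 * n) = qPoch a (q ^ 2) n * qPoch (a * q) (q ^ 2) n := by
  induction n with
  | zero => simp [qPoch_zero]
  | succ n ih =>
    rw [show 2 * (n + 1) = 2 * n + 1 + 1 by ring, qPoch_succ, qPoch_succ, ih, qPoch_succ,
      qPoch_succ]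
    ring

theorem qPochInf_eq_mul_qPochInf_sq (a : ℂ) {q : ℂ} (hq : ‖q‖ < 1) :
    qPochInf a q = qPochInf a (q ^ 2) * qPochInf (a * q) (q ^ 2) := by
  refine tendsto_nhds_unique
    ((tendsto_qPoch a hq).comp (tendsto_id.const_mul_atTop' two_pos)) ?_
  refine ((tendsto_qPoch a (norm_sq_lt_one hq)).mul
    (tendsto_qPoch (a * q) (norm_sq_lt_one hq))).congr fun n => ?_
  simp [qPoch_two_mul]

theorem qPochInf_mul_qPochInf_neg (a : ℂ) {q : ℂ} (hq : ‖q‖ < 1) :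
    qPochInf a q * qPochInf (-a) q = qPochInf (a ^ 2) (q ^ 2) := by
  rw [qPochInf, qPochInf, ← (multipliable_qPochInf a hq).tprod_mul (multipliable_qPochInf (-a) hq),
    qPochInf]
  exact tprod_congr fun k => by ring

/-! ### Bailey's summation -/

/-- The coefficient `(a; p)_n (c; p)_n p ^ (n choose 2) / (p ^ 2; p ^ 2)_n` of the Bailey series. -/
noncomputable def baileyCoeff (a c p : ℂ) (n : ℕ) : ℂ :=
  qPoch a p n * qPoch c p n * p ^ n.choose 2 / qPoch (p ^ 2) (p ^ 2) n

/-- The term of the Bailey series in the variable `b`. The denominator `(b; p)_n` of the usual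
form has been cleared by multiplying the series by `(b; p)_∞`, which leaves `(b p ^ n; p)_∞`. -/
noncomputable def baileyTerm (a c p b : ℂ) (n : ℕ) : ℂ :=
  baileyCoeff a c p n * b ^ n * qPochInf (b * p ^ n) p

theorem baileyCoeff_zero (a c p : ℂ) : baileyCoeff a c p 0 = 1 := by
  simp [baileyCoeff, qPoch_zero]

theorem baileyCoeff_succ (a c : ℂ) {p : ℂ} (hp : ‖p‖ < 1) (n : ℕ) :
    (1 - (p ^ 2) ^ (n + 1)) * baileyCoeff a c p (n + 1) =
      (1 - a * p ^ n) * (1 - c * p ^ n) * p ^ n * baileyCoeff a c p n := by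
  have hp2 := norm_sq_lt_one hp
  have h1 : qPoch (p ^ 2) (p ^ 2) n ≠ 0 := qPoch_ne_zero hp2 hp2 n
  have h2 : 1 - p ^ 2 * (p ^ 2) ^ n ≠ 0 := one_sub_mul_pow_ne_zero hp2 hp2 n
  have hc : (n + 1).choose 2 = n + n.choose 2 := by
    rw [Nat.choose_succ_succ' n 1, Nat.choose_one_right]
  rw [baileyCoeff, baileyCoeff, qPoch_succ, qPoch_succ, qPoch_succ, hc, pow_add, pow_succ' (p ^ 2)]
  field_simp
  ring

theorem exists_norm_baileyCoeff_le (a c : ℂ) {p : ℂ} (hp : ‖p‖ < 1) :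
    ∃ M, ∀ n, ‖baileyCoeff a c p n‖ ≤ M := by
  have hp2 := norm_sq_lt_one hp
  have ht : Tendsto (fun n => qPoch a p n * qPoch c p n / qPoch (p ^ 2) (p ^ 2) n) atTop
      (𝓝 (qPochInf a p * qPochInf c p / qPochInf (p ^ 2) (p ^ 2))) :=
    ((tendsto_qPoch a hp).mul (tendsto_qPoch c hp)).div (tendsto_qPoch _ hp2)
      (qPochInf_ne_zero hp2 hp2)
  obtain ⟨M, hM⟩ := (Metric.isBounded_range_of_tendsto _ ht).exists_norm_le
  refine ⟨M, fun n => ?_⟩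
  have h : baileyCoeff a c p n =
      qPoch a p n * qPoch c p n / qPoch (p ^ 2) (p ^ 2) n * p ^ n.choose 2 := by
    rw [baileyCoeff]
    ring
  rw [h, norm_mul, norm_pow]
  exact (mul_le_of_le_one_right (norm_nonneg _) (pow_le_one₀ (norm_nonneg p) hp.le)).trans
    (hM _ ⟨n, rfl⟩)

/-- A bound uniform in the disc `‖b‖ ≤ r`, which serves both for summability and as the dominating
function in the limit `b → 0`. -/
theorem exists_norm_baileyTerm_le (a c : ℂ) {p : ℂ} (hp : ‖p‖ < 1) :
    ∃ M, ∀ (r : ℝ) (b : ℂ) (n : ℕ), r ≤ 1 → ‖b‖ ≤ r → ‖baileyTerm a c p b n‖ ≤ M * r ^ n := by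
  obtain ⟨M, hM⟩ := exists_norm_baileyCoeff_le a c hp
  refine ⟨M * Real.exp (1 - ‖p‖)⁻¹, fun r b n hr hb => ?_⟩
  have hM0 : 0 ≤ M := (norm_nonneg _).trans (hM 0)
  have h1 : ‖b * p ^ n‖ ≤ 1 := by
    rw [norm_mul, norm_pow]
    exact mul_le_one₀ (hb.trans hr) (by positivity) (pow_le_one₀ (norm_nonneg p) hp.le)
  calc ‖baileyTerm a c p b n‖
      = ‖baileyCoeff a c p n‖ * ‖b‖ ^ n * ‖qPochInf (b * p ^ n) p‖ := by
        rw [baileyTerm, norm_mul, norm_mul, norm_pow]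
    _ ≤ M * r ^ n * Real.exp (1 - ‖p‖)⁻¹ := by
        have h0 : 0 ≤ r := (norm_nonneg b).trans hb
        gcongr
        · exact hM n
        · exact norm_qPochInf_le h1 hp
    _ = M * Real.exp (1 - ‖p‖)⁻¹ * r ^ n := by ring

theorem summable_baileyTerm (a c : ℂ) {p b : ℂ} (hp : ‖p‖ < 1) (hb : ‖b‖ < 1) :
    Summable (baileyTerm a c p b) := by
  obtain ⟨M, hM⟩ := exists_norm_baileyTerm_le a c hp
  exact .of_norm_bounded ((summable_geometric_of_lt_one (norm_nonneg b) hb).mul_left M)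
    fun n => hM ‖b‖ b n hb.le le_rfl

/-- The telescoping relation behind the functional equation in `b`. The certificate, written for
`baileyTerm`, is `(1 - p ^ (2 n)) / (1 - b p ^ n)`; in the form used here nothing is divided. -/
theorem baileyTerm_sub {a c p : ℂ} (hac : a * c = p) (hp : ‖p‖ < 1) (b : ℂ) (n : ℕ) :
    baileyTerm a c p b n - (1 - a * b) * (1 - c * b) * baileyTerm a c p (b * p ^ 2) n =
      (1 - (p ^ 2) ^ n) * baileyCoeff a c p n * b ^ n * qPochInf (b * p ^ (n + 1)) p -
      (1 - (p ^ 2) ^ (n + 1)) * baileyCoeff a c p (n + 1) * b ^ (n + 1) *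
        qPochInf (b * p ^ (n + 1 + 1)) p := by
  have e1 : qPochInf (b * p ^ n) p = (1 - b * p ^ n) * qPochInf (b * p ^ (n + 1)) p := by
    rw [qPochInf_eq_mul _ hp, mul_assoc b, ← pow_succ]
  have e2 : qPochInf (b * p ^ (n + 1)) p =
      (1 - b * p ^ (n + 1)) * qPochInf (b * p ^ (n + 1 + 1)) p := by
    rw [qPochInf_eq_mul _ hp, mul_assoc b, ← pow_succ]
  have e3 : b * p ^ 2 * p ^ n = b * p ^ (n + 1 + 1) := by ring
  rw [baileyCoeff_succ a c hp, baileyTerm, baileyTerm, e3, e1, e2]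
  generalize qPochInf (b * p ^ (n + 1 + 1)) p = P
  generalize baileyCoeff a c p n = A
  rw [mul_pow, pow_right_comm p 2 n, pow_succ p n, pow_succ b n]
  generalize p ^ n = x
  generalize b ^ n = y
  subst hac
  ring

/-- The functional equation of the Bailey series in `b`. -/
theorem tsum_baileyTerm_eq {a c p b : ℂ} (hac : a * c = p) (hp : ‖p‖ < 1) (hb : ‖b‖ < 1) :
    ∑' n, baileyTerm a c p b n =
      (1 - a * b) * (1 - c * b) * ∑' n, baileyTerm a c p (b * p ^ 2) n := by
  have hb2 : ‖b * p ^ 2‖ < 1 := by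
    rw [norm_mul]
    exact mul_lt_one_of_nonneg_of_lt_one_left (norm_nonneg b) hb (norm_sq_lt_one hp).le
  have h := ((summable_baileyTerm a c hp hb).hasSum.sub
    ((summable_baileyTerm a c hp hb2).hasSum.mul_left
      ((1 - a * b) * (1 - c * b)))).tendsto_sum_nat
  simp only [baileyTerm_sub hac hp b, Finset.sum_range_sub'] at h
  have h0 : Tendsto (fun n => (1 - (p ^ 2) ^ n) * baileyCoeff a c p n * b ^ n *
      qPochInf (b * p ^ (n + 1)) p) atTop (𝓝 0) := by
    obtain ⟨M, hM⟩ := exists_norm_baileyCoeff_le a c hp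
    refine squeeze_zero_norm (a := fun n => 2 * M * Real.exp ((1 - ‖p‖)⁻¹) * ‖b‖ ^ n) (fun n => ?_) ?_
    swap
    · simpa using (tendsto_pow_atTop_nhds_zero_of_lt_one (norm_nonneg b) hb).const_mul
        (2 * M * Real.exp ((1 - ‖p‖)⁻¹))
    have h1 : ‖b * p ^ (n + 1)‖ ≤ 1 := by
      rw [norm_mul, norm_pow]
      exact mul_le_one₀ hb.le (by positivity) (pow_le_one₀ (norm_nonneg p) hp.le)
    have h2 : ‖1 - (p ^ 2) ^ n‖ ≤ 2 := by
      refine (norm_sub_le _ _).trans ?_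
      have : ‖(p ^ 2) ^ n‖ ≤ 1 := by
        rw [norm_pow]
        exact pow_le_one₀ (norm_nonneg _) (norm_sq_lt_one hp).le
      rw [norm_one]
      linarith
    have hM0 : 0 ≤ M := (norm_nonneg _).trans (hM 0)
    rw [norm_mul, norm_mul, norm_mul, norm_pow]
    calc _ ≤ 2 * M * ‖b‖ ^ n * Real.exp (1 - ‖p‖)⁻¹ := by
          gcongr
          · exact hM n
          · exact norm_qPochInf_le h1 hp
      _ = _ := by ring
  have h3 := tendsto_nhds_unique h (h0.const_sub _)
  simp only [pow_zero, sub_self, zero_mul] at h3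
  exact sub_eq_zero.mp h3

theorem tsum_baileyTerm_eq_qPoch {a c p b : ℂ} (hac : a * c = p) (hp : ‖p‖ < 1) (hb : ‖b‖ < 1)
    (m : ℕ) :
    ∑' n, baileyTerm a c p b n = qPoch (a * b) (p ^ 2) m * qPoch (c * b) (p ^ 2) m *
      ∑' n, baileyTerm a c p (b * (p ^ 2) ^ m) n := by
  induction m with
  | zero => simp [qPoch_zero]
  | succ m ih =>
    have hbm : ‖b * (p ^ 2) ^ m‖ < 1 := by
      rw [norm_mul, norm_pow]
      exact mul_lt_one_of_nonneg_of_lt_one_left (norm_nonneg b) hb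
        (pow_le_one₀ (norm_nonneg _) (norm_sq_lt_one hp).le)
    rw [ih, tsum_baileyTerm_eq hac hp hbm, qPoch_succ, qPoch_succ, mul_assoc b, ← pow_succ]
    ring

/-- The `q`-analogue of Bailey's summation: the Bailey series sums to
`(a b; p ^ 2)_∞ (c b; p ^ 2)_∞` when `a c = p`. -/
theorem hasSum_baileyTerm {a c p b : ℂ} (hac : a * c = p) (hp : ‖p‖ < 1) (hb : ‖b‖ < 1) :
    HasSum (baileyTerm a c p b) (qPochInf (a * b) (p ^ 2) * qPochInf (c * b) (p ^ 2)) := by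
  have hp2 := norm_sq_lt_one hp
  have hu : Tendsto (fun m : ℕ => b * (p ^ 2) ^ m) atTop (𝓝 0) := by
    simpa using (tendsto_pow_atTop_nhds_zero_of_norm_lt_one hp2).const_mul b
  have hlim : Tendsto (fun m : ℕ => ∑' n, baileyTerm a c p (b * (p ^ 2) ^ m) n) atTop (𝓝 1) := by
    obtain ⟨M, hM⟩ := exists_norm_baileyTerm_le a c hp
    have h := tendsto_tsum_of_dominated_convergence (𝓕 := atTop)
      (f := fun m n => baileyTerm a c p (b * (p ^ 2) ^ m) n)
      (g := fun n => baileyCoeff a c p n * 0 ^ n * 1)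
      ((summable_geometric_of_lt_one (norm_nonneg b) hb).mul_left M)
      (fun n => ((hu.pow n).const_mul _).mul
        (tendsto_qPochInf_one (by simpa using hu.mul_const (p ^ n)) hp))
      (Eventually.of_forall fun m n => hM ‖b‖ _ n hb.le (by
        rw [norm_mul, norm_pow]
        exact mul_le_of_le_one_right (norm_nonneg b) (pow_le_one₀ (norm_nonneg _) hp2.le)))
    rwa [tsum_eq_single 0 fun n hn => by simp [hn], baileyCoeff_zero, pow_zero, mul_one,
      mul_one] at h
  have h := ((tendsto_qPoch (a * b) hp2).mul (tendsto_qPoch (c * b) hp2)).mul hlim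
  simp only [← tsum_baileyTerm_eq_qPoch hac hp hb, mul_one] at h
  rw [← tendsto_nhds_unique tendsto_const_nhds h]
  exact (summable_baileyTerm a c hp hb).hasSum

/-! ### The specialization `p = q ^ 4`, `a = q`, `c = q ^ 3`, `b = -q ^ 6` -/

theorem baileyTerm_specialize {q : ℂ} (hq4 : ‖q ^ 4‖ < 1) (h2 : qPochInf (-q ^ 2) (q ^ 4) ≠ 0)
    (n : ℕ) :
    baileyTerm q (q ^ 3) (q ^ 4) (-q ^ 6) n / qPochInf (-q ^ 2) (q ^ 4) =
      qPoch q (q ^ 2) (2 * n) * q ^ (2 * n ^ 2 + 4 * n) * (-1) ^ n /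
        (qPoch (q ^ 8) (q ^ 8) n * qPoch (-q ^ 2) (q ^ 4) (n + 1)) := by
  have hden : qPoch (-q ^ 2) (q ^ 4) (n + 1) * qPochInf (-q ^ 6 * (q ^ 4) ^ n) (q ^ 4) =
      qPochInf (-q ^ 2) (q ^ 4) := by
    rw [← qPoch_mul_qPochInf (-q ^ 2) hq4 (n + 1)]
    ring_nf
  have hpow : (q ^ 4) ^ n.choose 2 * (-q ^ 6) ^ n = q ^ (2 * n ^ 2 + 4 * n) * (-1) ^ n := by
    have hc : 4 * n.choose 2 + 6 * n = 2 * n ^ 2 + 4 * n := by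
      clear hden
      induction n with
      | zero => rfl
      | succ k ih =>
        rw [Nat.choose_succ_succ' k 1, Nat.choose_one_right]
        linarith
    rw [neg_pow, ← hc, pow_add, pow_mul, pow_mul]
    ring
  have hnum : qPoch q (q ^ 2) (2 * n) = qPoch q (q ^ 4) n * qPoch (q ^ 3) (q ^ 4) n := by
    rw [qPoch_two_mul]
    ring_nf
  -- `(-q ^ 2; q ^ 4)_∞` splits after `n + 1` factors, and its tail cancels against that of the term
  rw [← hden] at h2 ⊢
  have h3 := right_ne_zero_of_mul h2
  rw [baileyTerm, baileyCoeff, hnum, mul_assoc (qPoch q (q ^ 4) n * _), ← hpow,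
    show (q ^ 4) ^ 2 = q ^ 8 by ring, ← mul_div_mul_right _ (_ * qPoch (-q ^ 2) _ _) h3]
  rw [div_mul_eq_mul_div, div_mul_eq_mul_div, div_div]
  congr 1 <;> ring

theorem mainTheorem1 (q : ℂ) (hq : ‖q‖ < 1) :
    (∀ n : ℕ, qPoch (q ^ 8) (q ^ 8) n * qPoch (-q ^ 2) (q ^ 4) (n + 1) ≠ 0) ∧
    qPochInf (q ^ 4) (q ^ 4) ≠ 0 ∧
    HasSum
      (fun n : ℕ =>
        qPoch q (q ^ 2) (2 * n) * q ^ (2 * n ^ 2 + 4 * n) * (-1) ^ n /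
          (qPoch (q ^ 8) (q ^ 8) n * qPoch (-q ^ 2) (q ^ 4) (n + 1)))
      (qPochInf (-q ^ 9) (q ^ 8) * qPochInf (-q ^ 7) (q ^ 8) * qPochInf (q ^ 8) (q ^ 8) *
        qPochInf (q ^ 2) (q ^ 4) / qPochInf (q ^ 4) (q ^ 4)) := by
  have hpow : ∀ {k : ℕ}, k ≠ 0 → ‖q ^ k‖ < 1 := fun hk => by
    rw [norm_pow]
    exact pow_lt_one₀ (norm_nonneg q) hq hk
  have hneg : ∀ {k : ℕ}, k ≠ 0 → ‖-q ^ k‖ < 1 := fun hk => by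
    rw [norm_neg]
    exact hpow hk
  have hq4 : ‖q ^ 4‖ < 1 := hpow (by norm_num)
  have hq8 : ‖q ^ 8‖ < 1 := hpow (by norm_num)
  have h4 : qPochInf (q ^ 4) (q ^ 4) ≠ 0 := qPochInf_ne_zero hq4 hq4
  have h2 : qPochInf (-q ^ 2) (q ^ 4) ≠ 0 := qPochInf_ne_zero (hneg two_ne_zero) hq4
  refine ⟨fun n => mul_ne_zero (qPoch_ne_zero hq8 hq8 n)
    (qPoch_ne_zero (hneg two_ne_zero) hq4 (n + 1)), h4, ?_⟩
  have hS := (hasSum_baileyTerm (a := q) (c := q ^ 3) (by ring) hq4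
    (hneg (k := 6) (by norm_num))).div_const (qPochInf (-q ^ 2) (q ^ 4))
  simp only [baileyTerm_specialize hq4 h2] at hS
  have hprod : qPochInf (q ^ 2) (q ^ 4) * qPochInf (-q ^ 2) (q ^ 4) * qPochInf (q ^ 8) (q ^ 8) =
      qPochInf (q ^ 4) (q ^ 4) := by
    rw [qPochInf_mul_qPochInf_neg _ hq4, qPochInf_eq_mul_qPochInf_sq (q ^ 4) hq4]
    ring_nf
  have hval : qPochInf (-q ^ 9) (q ^ 8) * qPochInf (-q ^ 7) (q ^ 8) * qPochInf (q ^ 8) (q ^ 8) *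
      qPochInf (q ^ 2) (q ^ 4) / qPochInf (q ^ 4) (q ^ 4) =
      qPochInf (q * -q ^ 6) ((q ^ 4) ^ 2) * qPochInf (q ^ 3 * -q ^ 6) ((q ^ 4) ^ 2) /
        qPochInf (-q ^ 2) (q ^ 4) := by
    rw [div_eq_div_iff h4 h2, ← hprod, show q * -q ^ 6 = -q ^ 7 by ring,
      show q ^ 3 * -q ^ 6 = -q ^ 9 by ring, show (q ^ 4) ^ 2 = q ^ 8 by ring]
    ring
  rwa [hval]
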